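/- Let $f(x)=\frac{1+ix}{1-ix}$ be the Cayley function, and for a Hermitian $N\times N$ matrix $h$ write $f(h)=(I+ih)(I-ih)^{-1}$, which is a unitary matrix. Let $\mathbb{U}(N)$ be the group of $N\times N$ unitary matrices with its Haar probability measure $\mu_N$, and for probability measures $\mu,\rho$ on $\mathbb{U}(N)$ let $\|\mu-\rho\|_{\mathrm{TVD}}=\frac12|\mu-\rho|(\mathbb{U}(N))$ be their total variation distance, where $|\mu-\rho|$ is the total variation measure of the signed measure $\mu-\rho$ (equivalently, half the $L^1$-distance of their densities with respect to any dominating measure). For every $N$ there are constants $C>0$ and $\Delta_0>0$, depending only on $N$, such that the following holds. Let $H$ be a random unitary $N\times N$ matrix with distribution $\mu_N$, and let $h$ be a random Hermitian matrix, defined on the same probability space, with $H=f(h)$ almost surely. Then for all real $\Delta\le\Delta_0$ and all real $\theta$ with $|1-\theta|\le\Delta$, the distribution of the random unitary $f(\theta h)$ satisfies $$\bigl\|\mathrm{Law}(f(\theta h))-\mu_N\bigr\|_{\mathrm{TVD}}\le C\,\Delta .$$ -/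

import Mathlib

open MeasureTheory ProbabilityTheory

/-- Matrices carry the Borel sigma-algebra; the unitary group and the space of Hermitian
matrices inherit it as subtypes. -/
noncomputable instance measurableSpaceMatrix (N : ℕ) : MeasurableSpace (Matrix (Fin N) (Fin N) ℂ) := borel _

instance borelSpaceMatrix (N : ℕ) : BorelSpace (Matrix (Fin N) (Fin N) ℂ) := ⟨rfl⟩

open scoped ComplexOrder in
/-- For Hermitian `h` the matrix `1 - i h` is invertible, because
`(1 + i h) (1 - i h) = 1 + h ^ 2` is positive definite. -/
theorem isUnit_one_sub_I_smul {N : ℕ} {h : Matrix (Fin N) (Fin N) ℂ} (hh : h.IsHermitian) :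
    IsUnit (1 - Complex.I • h) := by
  have e : Matrix.conjTranspose (1 - Complex.I • h) * (1 - Complex.I • h)
      = 1 + h.conjTranspose * h := by
    simp only [Matrix.conjTranspose_sub, Matrix.conjTranspose_one, Matrix.conjTranspose_smul,
      hh.eq, Complex.star_def, Complex.conj_I]
    simp only [neg_smul, sub_neg_eq_add, add_mul, mul_sub, one_mul, mul_one, smul_mul_assoc,
      mul_smul_comm, smul_add, smul_smul, Complex.I_mul_I, one_smul]
    abel
  have p : (1 + h.conjTranspose * h).PosDef :=
    Matrix.PosDef.one.add_posSemidef (Matrix.posSemidef_conjTranspose_mul_self h)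
  have u := p.isUnit
  rw [← e] at u
  rw [Matrix.isUnit_iff_isUnit_det] at u ⊢
  rw [Matrix.det_mul] at u
  exact isUnit_of_mul_isUnit_right u

/-- The Cayley function `f(x) = (1 + i x) / (1 - i x)` evaluated at a square matrix. -/
noncomputable def cayleyMatrix {N : ℕ} (a : Matrix (Fin N) (Fin N) ℂ) :
    Matrix (Fin N) (Fin N) ℂ :=
  (1 + Complex.I • a) * (1 - Complex.I • a)⁻¹

theorem cayleyMatrix_mem_unitaryGroup {N : ℕ} {h : Matrix (Fin N) (Fin N) ℂ}
    (hh : h.IsHermitian) : cayleyMatrix h ∈ Matrix.unitaryGroup (Fin N) ℂ := by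
  have u := isUnit_one_sub_I_smul hh
  have ud := (Matrix.isUnit_iff_isUnit_det _).1 u
  have es : star (1 - Complex.I • h) = 1 + Complex.I • h := by
    rw [Matrix.star_eq_conjTranspose]
    simp [Matrix.conjTranspose_sub, Matrix.conjTranspose_smul, hh.eq]
  have es' : star (1 + Complex.I • h) = 1 - Complex.I • h := by
    rw [← es, star_star]
  have comm : (1 + Complex.I • h) * (1 - Complex.I • h)
      = (1 - Complex.I • h) * (1 + Complex.I • h) := by
    simp only [add_mul, mul_add, sub_mul, mul_sub, one_mul, mul_one]
    abel
  have ud' : IsUnit (1 + Complex.I • h).det := by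
    rw [← es, Matrix.star_eq_conjTranspose, Matrix.det_conjTranspose]
    exact ud.star
  rw [Matrix.mem_unitaryGroup_iff']
  unfold cayleyMatrix
  rw [star_mul, es', Matrix.star_eq_conjTranspose, Matrix.conjTranspose_nonsing_inv,
    ← Matrix.star_eq_conjTranspose, es]
  calc (1 + Complex.I • h)⁻¹ * (1 - Complex.I • h) * ((1 + Complex.I • h) * (1 - Complex.I • h)⁻¹)
      = (1 + Complex.I • h)⁻¹ * ((1 - Complex.I • h) * (1 + Complex.I • h))
          * (1 - Complex.I • h)⁻¹ := by simp only [Matrix.mul_assoc]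
    _ = 1 := by
      rw [← comm, ← Matrix.mul_assoc, Matrix.nonsing_inv_mul _ ud', Matrix.one_mul,
        Matrix.mul_nonsing_inv _ ud]

/-- The Cayley transform `h ↦ f(h)` from Hermitian matrices to the unitary group `U(N)`. -/
noncomputable def cayley {N : ℕ} (h : selfAdjoint (Matrix (Fin N) (Fin N) ℂ)) :
    Matrix.unitaryGroup (Fin N) ℂ :=
  ⟨cayleyMatrix h.1, cayleyMatrix_mem_unitaryGroup h.2⟩

instance compactSpace_unitaryGroup (N : ℕ) : CompactSpace (Matrix.unitaryGroup (Fin N) ℂ) := by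
  refine isCompact_iff_compactSpace.1 ?_
  have hK : IsCompact (Set.univ.pi fun _ : Fin N => Set.univ.pi fun _ : Fin N =>
      Metric.closedBall (0 : ℂ) 1) :=
    isCompact_univ_pi fun _ => isCompact_univ_pi fun _ => isCompact_closedBall _ _
  have hc : IsClosed (Matrix.unitaryGroup (Fin N) ℂ : Set (Matrix (Fin N) (Fin N) ℂ)) := by
    have : (Matrix.unitaryGroup (Fin N) ℂ : Set (Matrix (Fin N) (Fin N) ℂ))
        = {A | A * star A = 1} := by
      ext A
      exact Matrix.mem_unitaryGroup_iff
    rw [this]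
    exact isClosed_eq (continuous_id.mul continuous_star) continuous_const
  refine IsCompact.of_isClosed_subset hK hc ?_
  intro A hA i _ j _
  simpa using entry_norm_bound_of_unitary hA i j

/-- The Haar probability measure on `U(N)` (total mass one). -/
noncomputable def haarUnitary (N : ℕ) : Measure (Matrix.unitaryGroup (Fin N) ℂ) :=
  Measure.haarMeasure ⊤

instance isProbabilityMeasure_haarUnitary (N : ℕ) : IsProbabilityMeasure (haarUnitary N) :=
  ⟨by
    unfold haarUnitary
    exact Measure.haarMeasure_self (K₀ := ⊤)⟩

/-- Total variation distance: half the total mass of `|μ - ν|`, that is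
`(1/2) ∫ |dμ/dτ - dν/dτ| dτ` for any dominating measure `τ`. -/
noncomputable def tvDist {X : Type*} [MeasurableSpace X] (μ ν : Measure X)
    [IsFiniteMeasure μ] [IsFiniteMeasure ν] : ℝ :=
  (1 / 2) * (μ.toSignedMeasure - ν.toSignedMeasure).totalVariation.real Set.univ

/-!
Write `d` for the real dimension of the space of Hermitian matrices and equip matrices with the
operator norm. Left multiplication by a unitary matrix is an isometry of `U(N)`, and the Cayley
transform is bi-Lipschitz from the unit ball of Hermitian matrices onto a neighbourhood of `1` in
`U(N)`. Hence the `d`-dimensional Hausdorff measure of `U(N)` is left invariant, finite and nonzero,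
so it is a multiple of `haarUnitary N` (`isHaarMeasure_hausdorffMeasure_unitaryGroup`). In
particular a map between subsets of `U(N)` with Lipschitz constant `L` increases the outer Haar
measure at most by the factor `L ^ d` (`haarUnitary_image_le_of_dist_le`).

The resolvent identity
`f(h) - f(k) = 2 i (1 - i h)⁻¹ (h - k) (1 - i k)⁻¹`, applied to `h, k` and to `θ h, θ k`, shows
that `f(θ h) ↦ f(h)` is Lipschitz with constant `L = (1 + |1 - θ|) ^ 2 / θ`
(`dist_cayley_le_of_smul`). The set of those `f(h)` for which `f(θ h)` lies in `A` is the image of a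
subset of `A` under this map, so the law of `f(θ h)` is at most `L ^ d` times Haar measure
(`map_cayley_smul_apply_le`). A probability measure that is at most `M` times another one is within
`M - 1` of it in total variation (`tvDist_le_of_le_smul`), and `L ^ d - 1 = O(|1 - θ|)`.
-/

/-! ### Total variation, Hausdorff measure and a power estimate -/

section General

/-- The total variation distance of two probability measures `ν`, `μ` is `ν i - μ i`, where `i` is
the positive set of a Hahn decomposition of `ν - μ`. -/
theorem tvDist_le_of_le_smul {X : Type*} [MeasurableSpace X] (ν μ : Measure X)
    [IsProbabilityMeasure ν] [IsProbabilityMeasure μ] {M : ℝ} (hM : 1 ≤ M)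
    (h : ∀ s, MeasurableSet s → ν.real s ≤ M * μ.real s) :
    tvDist ν μ ≤ M - 1 := by
  set s := ν.toSignedMeasure - μ.toSignedMeasure with hs
  have hval : ∀ i, MeasurableSet i → s i = ν.real i - μ.real i := by
    intro i hi
    simp [hs, Measure.toSignedMeasure_apply_measurable hi]
  obtain ⟨i, hi, _, _, hpos, hneg⟩ := s.toJordanDecomposition_spec
  have hp : s.toJordanDecomposition.posPart.real Set.univ = s i := by
    rw [Measure.real, hpos, SignedMeasure.toMeasureOfZeroLE_apply _ _ hi MeasurableSet.univ]
    simp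
  have hn : s.toJordanDecomposition.negPart.real Set.univ = - s iᶜ := by
    rw [Measure.real, hneg,
      SignedMeasure.toMeasureOfLEZero_apply _ _ hi.compl MeasurableSet.univ]
    simp
  have hc : s iᶜ = - s i := by
    rw [hval _ hi, hval _ hi.compl, probReal_compl_eq_one_sub hi, probReal_compl_eq_one_sub hi]
    ring
  have e : tvDist ν μ = s i := by
    unfold tvDist
    rw [← hs, SignedMeasure.totalVariation, measureReal_add_apply, hp, hn, hc]
    ring
  have h1 : (M - 1) * μ.real i ≤ M - 1 :=
    mul_le_of_le_one_right (by linarith) measureReal_le_one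
  rw [e, hval _ hi]
  linarith [h _ hi]

open Measure in
/-- If the distances of the values of `f` are at most `K` times those of the values of `g`, then
`g x ↦ f x` is a well-defined `K`-Lipschitz map, here realized by choosing preimages under `g`. -/
theorem hausdorffMeasure_image_le_of_dist_le {X Y Z : Type*} [MetricSpace Y] [MeasurableSpace Y]
    [BorelSpace Y] [MetricSpace Z] [MeasurableSpace Z] [BorelSpace Z] {f : X → Y} {g : X → Z}
    {K : NNReal} {s : Set X}
    (h : ∀ x ∈ s, ∀ y ∈ s, dist (f x) (f y) ≤ K * dist (g x) (g y)) {d : ℝ} (hd : 0 ≤ d) :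
    μH[d] (f '' s) ≤ (K : ENNReal) ^ d * μH[d] (g '' s) := by
  rcases s.eq_empty_or_nonempty with rfl | ⟨x₀, hx₀⟩
  · simp
  have : Nonempty X := ⟨x₀⟩
  set φ : Z → Y := fun z => f (Function.invFunOn g s z)
  have hinv : ∀ z ∈ g '' s, Function.invFunOn g s z ∈ s ∧ g (Function.invFunOn g s z) = z :=
    fun z hz => ⟨Function.invFunOn_mem hz, Function.invFunOn_eq hz⟩
  have hφ : LipschitzOnWith K φ (g '' s) := by
    refine LipschitzOnWith.of_dist_le_mul fun z hz w hw => ?_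
    have := h _ (hinv z hz).1 _ (hinv w hw).1
    rwa [(hinv z hz).2, (hinv w hw).2] at this
  refine le_trans (measure_mono ?_) (hφ.hausdorffMeasure_image_le hd)
  rintro _ ⟨x, hx, rfl⟩
  refine ⟨g x, ⟨x, hx, rfl⟩, ?_⟩
  obtain ⟨h1, h2⟩ := hinv (g x) ⟨x, hx, rfl⟩
  have := h _ h1 _ hx
  rw [h2, dist_self, mul_zero] at this
  exact dist_le_zero.1 this

theorem one_add_pow_le_of_le_one {t : ℝ} (h0 : 0 ≤ t) (h1 : t ≤ 1) (n : ℕ) :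
    (1 + t) ^ n ≤ 1 + (2 ^ n - 1) * t := by
  induction n with
  | zero => simp
  | succ n ih =>
    have h2 : (1 : ℝ) ≤ 2 ^ n := one_le_pow₀ one_le_two
    have h3 : t * t ≤ t := mul_le_of_le_one_left h0 h1
    have h4 := mul_le_mul_of_nonneg_left h3 (sub_nonneg.2 h2)
    have h5 := mul_le_mul_of_nonneg_right ih (by linarith : 0 ≤ 1 + t)
    rw [pow_succ, pow_succ]
    nlinarith

end General

/-! ### Lipschitz estimates for the Cayley transform -/

section Cayley
open scoped Matrix.Norms.L2Operator
variable {N : ℕ}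
local notation "𝓜" => Matrix (Fin N) (Fin N) ℂ

/-- For `N = 0` the norm of `1` is `0`. -/
theorem norm_one_matrix_le : ‖(1 : 𝓜)‖ ≤ 1 := by
  rcases subsingleton_or_nontrivial 𝓜 with h | h
  · simp [Subsingleton.elim (1 : 𝓜) 0]
  · exact CStarRing.norm_one.le

theorem norm_coe_unitaryGroup_le (U : Matrix.unitaryGroup (Fin N) ℂ) : ‖(U : 𝓜)‖ ≤ 1 := by
  rcases subsingleton_or_nontrivial 𝓜 with h | h
  · simp [Subsingleton.elim (U : 𝓜) 0]
  · exact (CStarRing.norm_coe_unitary U).le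

theorem mul_nonsing_inv_one_sub_I_smul {h : 𝓜} (hh : h.IsHermitian) :
    (1 - Complex.I • h) * (1 - Complex.I • h)⁻¹ = 1 :=
  Matrix.mul_nonsing_inv _ ((Matrix.isUnit_iff_isUnit_det _).1 (isUnit_one_sub_I_smul hh))

theorem nonsing_inv_mul_one_sub_I_smul {h : 𝓜} (hh : h.IsHermitian) :
    (1 - Complex.I • h)⁻¹ * (1 - Complex.I • h) = 1 :=
  Matrix.nonsing_inv_mul _ ((Matrix.isUnit_iff_isUnit_det _).1 (isUnit_one_sub_I_smul hh))

theorem cayleyMatrix_eq {h : 𝓜} (hh : h.IsHermitian) :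
    cayleyMatrix h = (2 : ℂ) • (1 - Complex.I • h)⁻¹ - 1 := by
  unfold cayleyMatrix
  have e : 1 + Complex.I • h = (2 : ℂ) • (1 : 𝓜) - (1 - Complex.I • h) := by
    rw [two_smul]; abel
  rw [e, sub_mul, mul_nonsing_inv_one_sub_I_smul hh, smul_mul_assoc, one_mul]

/-- The resolvent identity for the Cayley transform, in multiplied-out form. -/
theorem one_sub_mul_cayleyMatrix_sub_mul {h k : 𝓜} (hh : h.IsHermitian) (hk : k.IsHermitian) :
    (1 - Complex.I • h) * (cayleyMatrix h - cayleyMatrix k) * (1 - Complex.I • k)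
      = (2 * Complex.I) • (h - k) := by
  rw [cayleyMatrix_eq hh, cayleyMatrix_eq hk, sub_sub_sub_cancel_right, ← smul_sub,
    mul_smul_comm, smul_mul_assoc, mul_sub (1 - Complex.I • h), sub_mul _ _ (1 - Complex.I • k),
    mul_nonsing_inv_one_sub_I_smul hh, mul_assoc, nonsing_inv_mul_one_sub_I_smul hk, one_mul,
    mul_one, mul_smul, sub_sub_sub_cancel_left, ← smul_sub]

theorem cayleyMatrix_sub {h k : 𝓜} (hh : h.IsHermitian) (hk : k.IsHermitian) :
    cayleyMatrix h - cayleyMatrix k =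
      (1 - Complex.I • h)⁻¹ * ((2 * Complex.I) • (h - k)) * (1 - Complex.I • k)⁻¹ := by
  rw [← one_sub_mul_cayleyMatrix_sub_mul hh hk, ← mul_assoc, ← mul_assoc,
    nonsing_inv_mul_one_sub_I_smul hh, one_mul, mul_assoc, mul_nonsing_inv_one_sub_I_smul hk,
    mul_one]

theorem norm_cayleyMatrix_le {h : 𝓜} (hh : h.IsHermitian) : ‖cayleyMatrix h‖ ≤ 1 :=
  norm_coe_unitaryGroup_le ⟨_, cayleyMatrix_mem_unitaryGroup hh⟩

theorem nonsing_inv_one_sub_I_smul_eq {h : 𝓜} (hh : h.IsHermitian) :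
    (1 - Complex.I • h)⁻¹ = (1 / 2 : ℂ) • (1 + cayleyMatrix h) := by
  rw [cayleyMatrix_eq hh, add_sub_cancel, smul_smul]
  norm_num

theorem norm_nonsing_inv_one_sub_I_smul_le {h : 𝓜} (hh : h.IsHermitian) :
    ‖(1 - Complex.I • h)⁻¹‖ ≤ 1 := by
  rw [nonsing_inv_one_sub_I_smul_eq hh, norm_smul]
  have := (norm_add_le (1 : 𝓜) (cayleyMatrix h)).trans
    (add_le_add norm_one_matrix_le (norm_cayleyMatrix_le hh))
  norm_num at this ⊢
  linarith

/-- A norm bound for `(1 - i h)⁻¹ (1 - i θ h)`, which is this combination of `1` and the unitary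
matrix `f(h)` by `nonsing_inv_mul_one_sub_smul`. -/
theorem norm_smul_one_add_smul_cayleyMatrix_le {h : 𝓜} (hh : h.IsHermitian) (θ : ℝ) :
    ‖((1 + θ) / 2 : ℂ) • (1 : 𝓜) + ((1 - θ) / 2 : ℂ) • cayleyMatrix h‖ ≤ 1 + |1 - θ| := by
  refine (norm_add_le _ _).trans ?_
  rw [norm_smul, norm_smul]
  have e1 : ‖((1 + θ) / 2 : ℂ)‖ = |1 + θ| / 2 := by
    rw [← Complex.ofReal_one, ← Complex.ofReal_add, norm_div, Complex.norm_real]; simp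
  have e2 : ‖((1 - θ) / 2 : ℂ)‖ = |1 - θ| / 2 := by
    rw [← Complex.ofReal_one, ← Complex.ofReal_sub, norm_div, Complex.norm_real]; simp
  rw [e1, e2]
  have h1 := mul_le_mul_of_nonneg_left (norm_one_matrix_le (N := N))
    (by positivity : 0 ≤ |1 + θ| / 2)
  have h2 := mul_le_mul_of_nonneg_left (norm_cayleyMatrix_le hh)
    (by positivity : 0 ≤ |1 - θ| / 2)
  have h3 : |1 + θ| ≤ 2 + |1 - θ| := by
    have := abs_sub (2 : ℝ) (1 - θ)
    rwa [show (2 : ℝ) - (1 - θ) = 1 + θ by ring, abs_two] at this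
  linarith

theorem one_sub_I_smul_smul_eq {h : 𝓜} (hh : h.IsHermitian) (θ : ℝ) :
    ((1 + θ) / 2 : ℂ) • (1 : 𝓜) + ((1 - θ) / 2 : ℂ) • cayleyMatrix h
      = (θ : ℂ) • 1 + (1 - θ : ℂ) • (1 - Complex.I • h)⁻¹ := by
  rw [cayleyMatrix_eq hh]
  module

theorem nonsing_inv_mul_one_sub_smul {h : 𝓜} (hh : h.IsHermitian) (θ : ℝ) :
    (1 - Complex.I • h)⁻¹ * (1 - Complex.I • (θ • h))
      = ((1 + θ) / 2 : ℂ) • (1 : 𝓜) + ((1 - θ) / 2 : ℂ) • cayleyMatrix h := by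
  rw [one_sub_I_smul_smul_eq hh]
  have e : 1 - Complex.I • (θ • h) = (θ : ℂ) • (1 - Complex.I • h) + (1 - θ : ℂ) • (1 : 𝓜) := by
    rw [← Complex.coe_smul]
    module
  rw [e, mul_add, mul_smul_comm, nonsing_inv_mul_one_sub_I_smul hh, mul_smul_comm, mul_one]

theorem one_sub_smul_mul_nonsing_inv {h : 𝓜} (hh : h.IsHermitian) (θ : ℝ) :
    (1 - Complex.I • (θ • h)) * (1 - Complex.I • h)⁻¹
      = ((1 + θ) / 2 : ℂ) • (1 : 𝓜) + ((1 - θ) / 2 : ℂ) • cayleyMatrix h := by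
  rw [one_sub_I_smul_smul_eq hh]
  have e : 1 - Complex.I • (θ • h) = (θ : ℂ) • (1 - Complex.I • h) + (1 - θ : ℂ) • (1 : 𝓜) := by
    rw [← Complex.coe_smul]
    module
  rw [e, add_mul, smul_mul_assoc, mul_nonsing_inv_one_sub_I_smul hh, smul_mul_assoc, one_mul]

/-- The resolvent identities for `(h, k)` and `(θ h, θ k)`, with `h - k` eliminated. -/
theorem smul_cayleyMatrix_sub {h k : 𝓜} (hh : h.IsHermitian) (hk : k.IsHermitian) (θ : ℝ)
    (hθh : (θ • h).IsHermitian) (hθk : (θ • k).IsHermitian) :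
    θ • (cayleyMatrix h - cayleyMatrix k) =
      (((1 + θ) / 2 : ℂ) • (1 : 𝓜) + ((1 - θ) / 2 : ℂ) • cayleyMatrix h)
        * (cayleyMatrix (θ • h) - cayleyMatrix (θ • k))
        * (((1 + θ) / 2 : ℂ) • (1 : 𝓜) + ((1 - θ) / 2 : ℂ) • cayleyMatrix k) := by
  have e := one_sub_mul_cayleyMatrix_sub_mul hθh hθk
  rw [← nonsing_inv_mul_one_sub_smul hh, ← one_sub_smul_mul_nonsing_inv hk, cayleyMatrix_sub hh hk,
    ← smul_mul_assoc, ← mul_smul_comm, smul_comm θ, smul_sub θ, ← e]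
  simp only [mul_assoc]

/-- The map `f(θ h) ↦ f(h)` is Lipschitz, with a constant tending to `1` as `θ → 1`. -/
theorem dist_cayley_le_of_smul (h k : selfAdjoint 𝓜) {θ : ℝ} (hθ : 0 < θ) :
    dist (cayley h) (cayley k)
      ≤ (1 + |1 - θ|) ^ 2 / θ * dist (cayley (θ • h)) (cayley (θ • k)) := by
  have e := congrArg norm (smul_cayleyMatrix_sub h.2 k.2 θ (θ • h).2 (θ • k).2)
  rw [norm_smul, Real.norm_of_nonneg hθ.le] at e
  have hd : ∀ a b : selfAdjoint 𝓜, dist (cayley a) (cayley b)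
      = ‖cayleyMatrix (a : 𝓜) - cayleyMatrix (b : 𝓜)‖ := fun a b => by
    rw [Subtype.dist_eq, dist_eq_norm]; rfl
  rw [hd, hd, div_mul_eq_mul_div, le_div_iff₀ hθ, mul_comm, e]
  refine (norm_mul_le _ _).trans ?_
  calc _ ≤ (1 + |1 - θ|) * ‖cayleyMatrix (θ • h : 𝓜) - cayleyMatrix (θ • k : 𝓜)‖
          * (1 + |1 - θ|) := by
        gcongr
        · exact (norm_mul_le _ _).trans (by
            gcongr; exact norm_smul_one_add_smul_cayleyMatrix_le h.2 θ)
        · exact norm_smul_one_add_smul_cayleyMatrix_le k.2 θ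
    _ = _ := by
        rw [selfAdjoint.val_smul, selfAdjoint.val_smul]; ring

theorem dist_cayley_le (h k : selfAdjoint 𝓜) : dist (cayley h) (cayley k) ≤ 2 * dist h k := by
  rw [Subtype.dist_eq, Subtype.dist_eq, dist_eq_norm, dist_eq_norm]
  change ‖cayleyMatrix (h : 𝓜) - cayleyMatrix (k : 𝓜)‖ ≤ _
  rw [cayleyMatrix_sub h.2 k.2]
  calc _ ≤ 1 * ‖(2 * Complex.I) • ((h : 𝓜) - k)‖ * 1 := by
        refine (norm_mul_le _ _).trans ?_
        gcongr
        · exact (norm_mul_le _ _).trans (by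
            gcongr; exact norm_nonsing_inv_one_sub_I_smul_le h.2)
        · exact norm_nonsing_inv_one_sub_I_smul_le k.2
    _ = _ := by simp [norm_smul]

theorem continuous_cayley : Continuous (cayley (N := N)) :=
  (LipschitzWith.of_dist_le_mul (K := 2) dist_cayley_le).continuous

theorem norm_one_sub_I_smul_le {h : 𝓜} (hh : ‖h‖ ≤ 1) : ‖1 - Complex.I • h‖ ≤ 2 := by
  refine (norm_sub_le _ _).trans ?_
  rw [norm_smul, Complex.norm_I, one_mul]
  linarith [norm_one_matrix_le (N := N)]

theorem norm_sub_le_two_mul_norm_cayleyMatrix_sub {h k : 𝓜} (hh : h.IsHermitian)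
    (hk : k.IsHermitian) (hh1 : ‖h‖ ≤ 1) (hk1 : ‖k‖ ≤ 1) :
    ‖h - k‖ ≤ 2 * ‖cayleyMatrix h - cayleyMatrix k‖ := by
  have e := congrArg norm (one_sub_mul_cayleyMatrix_sub_mul hh hk)
  have h1 := norm_mul₃_le (a := 1 - Complex.I • h) (b := cayleyMatrix h - cayleyMatrix k)
    (c := 1 - Complex.I • k)
  have h2 : ‖1 - Complex.I • h‖ * ‖cayleyMatrix h - cayleyMatrix k‖ * ‖1 - Complex.I • k‖
      ≤ 2 * ‖cayleyMatrix h - cayleyMatrix k‖ * 2 :=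
    mul_le_mul (mul_le_mul_of_nonneg_right (norm_one_sub_I_smul_le hh1) (norm_nonneg _))
      (norm_one_sub_I_smul_le hk1) (norm_nonneg _) (by positivity)
  rw [e, norm_smul, norm_mul, Complex.norm_I, Complex.norm_two] at h1
  linarith

theorem dist_le_two_mul_dist_cayley {h k : selfAdjoint 𝓜} (hh : ‖h‖ ≤ 1) (hk : ‖k‖ ≤ 1) :
    dist h k ≤ 2 * dist (cayley h) (cayley k) := by
  rw [Subtype.dist_eq, Subtype.dist_eq, dist_eq_norm, dist_eq_norm]
  exact norm_sub_le_two_mul_norm_cayleyMatrix_sub h.2 k.2 hh hk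

/-- Near `1` the Cayley transform is inverted by `U ↦ -i (U - 1) (U + 1)⁻¹`. -/
theorem exists_cayley_eq_of_norm_sub_one_lt (U : Matrix.unitaryGroup (Fin N) ℂ)
    (hU : ‖(U : 𝓜) - 1‖ < 1) : ∃ h : selfAdjoint 𝓜, ‖h‖ ≤ 1 ∧ cayley h = U := by
  set A : 𝓜 := (U : 𝓜)
  have hunit : IsUnit (A + 1) := by
    have h1 : ‖-((1 / 2 : ℂ) • (A - 1))‖ < 1 := by
      rw [norm_neg, norm_smul]; norm_num; linarith
    have h2 := isUnit_one_sub_of_norm_lt_one h1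
    have h3 : A + 1 = (2 : ℂ) • (1 - -((1 / 2 : ℂ) • (A - 1))) := by module
    rw [h3]
    exact h2.smul (Units.mk0 (2 : ℂ) two_ne_zero)
  have hdet := (Matrix.isUnit_iff_isUnit_det _).1 hunit
  set V : 𝓜 := (A + 1)⁻¹
  have hVl : V * (A + 1) = 1 := Matrix.nonsing_inv_mul _ hdet
  have hVr : (A + 1) * V = 1 := Matrix.mul_nonsing_inv _ hdet
  have hUU : A * star A = 1 := Matrix.mem_unitaryGroup_iff.1 U.2
  set h : 𝓜 := -Complex.I • ((A - 1) * V) with hh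
  have hmul : h * (A + 1) = -Complex.I • (A - 1) := by
    rw [hh, smul_mul_assoc, mul_assoc, hVl, mul_one]
  have hsa : star h = h := by
    -- It suffices to compare `h` and `star h` after multiplication by the invertible `A + 1`.
    have e1 : (star A + 1) * star h = Complex.I • (star A - 1) := by
      have := congrArg star hmul
      simpa [star_mul, star_smul] using this
    have e2 : (A + 1) * star h = (A + 1) * h := by
      have l : (A + 1) * star h = Complex.I • (1 - A) := by
        calc _ = A * ((star A + 1) * star h) := by
              rw [← mul_assoc, mul_add, hUU, mul_one, add_comm]
          _ = _ := by rw [e1, mul_smul_comm, mul_sub, hUU, mul_one]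
      have r : (A + 1) * h = Complex.I • (1 - A) := by
        have c : (A + 1) * (A - 1) = (A - 1) * (A + 1) := by noncomm_ring
        rw [hh, mul_smul_comm, ← mul_assoc, c, mul_assoc, hVr, mul_one, neg_smul, ← smul_neg,
          neg_sub]
      rw [l, r]
    have := congrArg (V * ·) e2
    simpa only [← mul_assoc, hVl, one_mul] using this
  have hIh : Complex.I • h = (A - 1) * V := by
    rw [hh, smul_smul]; simp
  clear_value h
  refine ⟨⟨h, hsa⟩, ?_, ?_⟩
  · change ‖h‖ ≤ 1
    -- The equation `h (A + 1) = -i (A - 1)` gives `2 ‖h‖ ≤ ‖A - 1‖ + ‖h‖ ‖A - 1‖ ≤ 1 + ‖h‖`.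
    have e : (2 : ℂ) • h = -Complex.I • (A - 1) - h * (A - 1) := by
      rw [← hmul, ← mul_sub, two_smul]
      noncomm_ring
    have h1 := congrArg norm e
    have h2 := norm_sub_le (-Complex.I • (A - 1)) (h * (A - 1))
    have h3 := norm_mul_le h (A - 1)
    rw [← h1, norm_smul] at h2
    rw [norm_smul, norm_neg, Complex.norm_I, one_mul, Complex.norm_two] at h2
    have h4 : ‖h‖ * ‖A - 1‖ ≤ ‖h‖ * 1 := by gcongr
    linarith
  · apply Subtype.ext
    change (1 + Complex.I • h) * (1 - Complex.I • h)⁻¹ = A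
    have e1 : 1 + Complex.I • h = A * (1 - Complex.I • h) := by
      have p : 1 - Complex.I • h = (2 : ℂ) • V := by
        rw [hIh]
        nth_rewrite 1 [← hVr]
        rw [← sub_mul, add_sub_sub_cancel, ← two_smul ℂ, smul_mul_assoc, one_mul]
      have q : 1 + Complex.I • h = (2 : ℂ) • (A * V) := by
        rw [hIh]
        nth_rewrite 1 [← hVr]
        rw [← add_mul, add_add_sub_cancel, ← two_smul ℂ, smul_mul_assoc]
      rw [p, q, mul_smul_comm]
    rw [e1, mul_assoc, mul_nonsing_inv_one_sub_I_smul (h := h) hsa, mul_one]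

end Cayley

/-! ### Haar measure as Hausdorff measure -/

section Haar
open scoped Matrix.Norms.L2Operator
open Measure Module
variable {N : ℕ}
local notation "𝓜" => Matrix (Fin N) (Fin N) ℂ

instance isIsometricSMul_unitaryGroup :
    IsIsometricSMul (Matrix.unitaryGroup (Fin N) ℂ) (Matrix.unitaryGroup (Fin N) ℂ) where
  isometry_smul U := by
    refine Isometry.of_dist_eq fun V W => ?_
    rw [Subtype.dist_eq, Subtype.dist_eq, dist_eq_norm, dist_eq_norm]
    change ‖(U : 𝓜) * V - U * W‖ = _
    rw [← mul_sub, CStarRing.norm_coe_unitary_mul]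

instance finiteDimensional_selfAdjoint : FiniteDimensional ℝ (selfAdjoint 𝓜) :=
  inferInstanceAs (FiniteDimensional ℝ (selfAdjoint.submodule ℝ 𝓜))

instance borelSpace_selfAdjoint : BorelSpace (selfAdjoint 𝓜) := Subtype.borelSpace _

instance borelSpace_unitaryGroup : BorelSpace (Matrix.unitaryGroup (Fin N) ℂ) :=
  Subtype.borelSpace _

/-- The Hausdorff measure of `U(N)` in dimension `dim U(N)` is a Haar measure: the image of the
closed unit ball under the Cayley transform is a compact neighbourhood of `1`, and its measure is
finite and nonzero because the Cayley transform is bi-Lipschitz there. -/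
theorem isHaarMeasure_hausdorffMeasure_unitaryGroup :
    IsHaarMeasure (μH[finrank ℝ (selfAdjoint 𝓜)] : Measure (Matrix.unitaryGroup (Fin N) ℂ)) := by
  have : IsMulLeftInvariant
      (μH[finrank ℝ (selfAdjoint 𝓜)] : Measure (Matrix.unitaryGroup (Fin N) ℂ)) :=
    ⟨fun U => (IsometryEquiv.constSMul U).map_hausdorffMeasure _⟩
  have hK : IsCompact (Metric.closedBall (0 : selfAdjoint 𝓜) 1) := by
    have := FiniteDimensional.proper_real (selfAdjoint 𝓜)
    exact isCompact_closedBall _ _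
  refine isHaarMeasure_of_isCompact_nonempty_interior _ (cayley '' Metric.closedBall 0 1)
    (hK.image continuous_cayley) ?_ ?_ ?_
  · refine ⟨1, mem_interior.2 ⟨Metric.ball 1 1, fun U hU => ?_, Metric.isOpen_ball,
      Metric.mem_ball_self one_pos⟩⟩
    rw [Metric.mem_ball, Subtype.dist_eq, dist_eq_norm] at hU
    obtain ⟨h, hh, e⟩ := exists_cayley_eq_of_norm_sub_one_lt U hU
    exact ⟨h, by simpa using hh, e⟩
  · intro h0
    have := hausdorffMeasure_image_le_of_dist_le (f := id) (g := cayley (N := N)) (K := 2)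
      (s := Metric.closedBall 0 1) (d := finrank ℝ (selfAdjoint 𝓜))
      (fun h hh k hk => dist_le_two_mul_dist_cayley (by simpa using hh) (by simpa using hk))
      (Nat.cast_nonneg _)
    rw [h0, mul_zero, Set.image_id] at this
    exact (Metric.measure_closedBall_pos (μH[finrank ℝ (selfAdjoint 𝓜)]) (0 : selfAdjoint 𝓜)
      one_pos).ne' (le_antisymm this zero_le)
  · refine ne_top_of_le_ne_top ?_ ((LipschitzWith.of_dist_le_mul (K := 2)
      dist_cayley_le).hausdorffMeasure_image_le (Nat.cast_nonneg _) _)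
    refine ENNReal.mul_ne_top ?_ hK.measure_lt_top.ne
    exact ENNReal.rpow_ne_top_of_nonneg (Nat.cast_nonneg _) ENNReal.coe_ne_top

/-- A `K`-Lipschitz correspondence `g x ↦ f x` between subsets of `U(N)` increases outer Haar
measure by at most the factor `K ^ dim U(N)`. -/
theorem haarUnitary_image_le_of_dist_le {X : Type*} {f g : X → Matrix.unitaryGroup (Fin N) ℂ}
    {K : NNReal} {s : Set X} (h : ∀ x ∈ s, ∀ y ∈ s, dist (f x) (f y) ≤ K * dist (g x) (g y)) :
    haarUnitary N (f '' s)
      ≤ (K : ENNReal) ^ finrank ℝ (selfAdjoint 𝓜) * haarUnitary N (g '' s) := by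
  have := isHaarMeasure_hausdorffMeasure_unitaryGroup (N := N)
  have e := haarMeasure_unique
    (μH[finrank ℝ (selfAdjoint 𝓜)] : Measure (Matrix.unitaryGroup (Fin N) ℂ)) ⊤
  set c := (μH[finrank ℝ (selfAdjoint 𝓜)] : Measure (Matrix.unitaryGroup (Fin N) ℂ))
    ((⊤ : TopologicalSpace.PositiveCompacts (Matrix.unitaryGroup (Fin N) ℂ)) : Set _) with hc
  have hc0 : c ≠ 0 := by
    rw [hc, TopologicalSpace.PositiveCompacts.coe_top]
    exact isOpen_univ.measure_ne_zero _ Set.univ_nonempty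
  have hct : c ≠ ⊤ := by
    rw [hc, TopologicalSpace.PositiveCompacts.coe_top]
    exact isCompact_univ.measure_lt_top.ne
  have k := hausdorffMeasure_image_le_of_dist_le h
    (Nat.cast_nonneg (finrank ℝ (selfAdjoint 𝓜)) : (0 : ℝ) ≤ _)
  rw [e, ENNReal.rpow_natCast, Measure.smul_apply, Measure.smul_apply, smul_eq_mul, smul_eq_mul,
    mul_left_comm] at k
  exact (ENNReal.mul_le_mul_iff_right hc0 hct).1 k

/-- The law of `f(θ h)` is dominated by a multiple, close to `1`, of Haar measure. -/
theorem map_cayley_smul_apply_le {Ω : Type*} [MeasurableSpace Ω] {P : Measure Ω}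
    {H : Ω → Matrix.unitaryGroup (Fin N) ℂ} {h : Ω → selfAdjoint 𝓜}
    (hH : HasLaw H (haarUnitary N) P) (hh : AEMeasurable h P)
    (hHh : ∀ᵐ ω ∂P, H ω = cayley (h ω)) {θ : ℝ} (hθ : 0 < θ)
    {A : Set (Matrix.unitaryGroup (Fin N) ℂ)} (hA : MeasurableSet A) :
    (P.map fun ω => cayley (θ • h ω)) A
      ≤ ENNReal.ofReal ((1 + |1 - θ|) ^ 2 / θ) ^ finrank ℝ (selfAdjoint 𝓜) * haarUnitary N A := by
  set S : Set (selfAdjoint 𝓜) := {a | cayley (θ • a) ∈ A}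
  have hm : AEMeasurable (fun ω => cayley (θ • h ω)) P :=
    (continuous_cayley.comp (continuous_const_smul θ)).measurable.comp_aemeasurable hh
  -- The set `cayley '' S` need not be known to be measurable: a measurable hull replaces it.
  set B := toMeasurable (haarUnitary N) (cayley '' S)
  calc (P.map fun ω => cayley (θ • h ω)) A
      = P ((fun ω => cayley (θ • h ω)) ⁻¹' A) := map_apply_of_aemeasurable hm hA
    _ ≤ P (H ⁻¹' B) := by
        refine measure_mono_ae ?_
        filter_upwards [hHh] with ω hω hmem
        change H ω ∈ B
        rw [hω]
        exact subset_toMeasurable _ _ ⟨h ω, hmem, rfl⟩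
    _ = haarUnitary N (cayley '' S) := by
        rw [← map_apply_of_aemeasurable hH.aemeasurable (measurableSet_toMeasurable _ _),
          hH.map_eq, measure_toMeasurable]
    _ ≤ _ := by
        refine (haarUnitary_image_le_of_dist_le (g := fun a => cayley (θ • a))
          (K := Real.toNNReal ((1 + |1 - θ|) ^ 2 / θ)) fun a _ b _ => ?_).trans ?_
        · rw [Real.coe_toNNReal _ (by positivity)]
          exact dist_cayley_le_of_smul a b hθ
        · refine mul_le_mul_right (measure_mono ?_) _
          rintro _ ⟨a, ha, rfl⟩
          exact ha

theorem isProbabilityMeasure_map_cayley_smul {Ω : Type*} [MeasurableSpace Ω] {P : Measure Ω}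
    [IsProbabilityMeasure P] {h : Ω → selfAdjoint 𝓜} (hh : AEMeasurable h P) (θ : ℝ) :
    IsProbabilityMeasure (P.map fun ω => cayley (θ • h ω)) :=
  isProbabilityMeasure_map
    ((continuous_cayley.comp (continuous_const_smul θ)).measurable.comp_aemeasurable hh)

/-- The Lipschitz constant of `f(θ h) ↦ f(h)` is at most `(1 + 2 δ) ^ 3` when `|1 - θ| ≤ δ ≤ 1 / 2`,
because then `1 / θ ≤ 1 + 2 δ`. -/
theorem distortion_pow_le {δ θ : ℝ} (hδ : δ ≤ 1 / 2) (hθ : |1 - θ| ≤ δ) (n : ℕ) :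
    ((1 + |1 - θ|) ^ 2 / θ) ^ n ≤ 1 + (2 ^ (3 * n) - 1) * (2 * δ) := by
  have h0 : 0 ≤ δ := (abs_nonneg _).trans hθ
  have hθ' : 1 - δ ≤ θ := by linarith [le_abs_self (1 - θ)]
  have hpos : 0 < θ := by linarith
  have h1 : (1 + |1 - θ|) ^ 2 / θ ≤ (1 + 2 * δ) ^ 3 := by
    rw [div_le_iff₀ hpos]
    have h2 : 1 ≤ (1 + 2 * δ) * θ := by nlinarith
    calc (1 + |1 - θ|) ^ 2 ≤ (1 + 2 * δ) ^ 2 * 1 := by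
          rw [mul_one]; gcongr; linarith
      _ ≤ (1 + 2 * δ) ^ 2 * ((1 + 2 * δ) * θ) := by gcongr
      _ = _ := by ring
  calc _ ≤ ((1 + 2 * δ) ^ 3) ^ n := by gcongr
    _ = (1 + 2 * δ) ^ (3 * n) := by rw [pow_mul]
    _ ≤ _ := one_add_pow_le_of_le_one (by linarith) (by linarith) _

end Haar

theorem mainTheorem4 (N : ℕ) :
    ∃ C : ℝ, 0 < C ∧ ∃ Δ₀ : ℝ, 0 < Δ₀ ∧
      ∀ (Ω : Type*) [MeasurableSpace Ω] (P : Measure Ω) [IsProbabilityMeasure P]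
        (H : Ω → Matrix.unitaryGroup (Fin N) ℂ)
        (h : Ω → selfAdjoint (Matrix (Fin N) (Fin N) ℂ)),
        HasLaw H (haarUnitary N) P →
        AEMeasurable h P →
        (∀ᵐ ω ∂P, H ω = cayley (h ω)) →
        ∀ Δ θ : ℝ, Δ ≤ Δ₀ → |1 - θ| ≤ Δ →
          tvDist (P.map fun ω => cayley (θ • h ω)) (haarUnitary N) ≤ C * Δ := by
  set n := Module.finrank ℝ (selfAdjoint (Matrix (Fin N) (Fin N) ℂ))
  refine ⟨2 ^ (3 * n + 1), by positivity, 1 / 2, by norm_num, ?_⟩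
  intro Ω _ P _ H h hH hh hHh Δ θ hΔ hθ
  have hΔ0 : 0 ≤ Δ := (abs_nonneg _).trans hθ
  have hpos : 0 < θ := by linarith [le_abs_self (1 - θ)]
  have := isProbabilityMeasure_map_cayley_smul hh θ
  have h1 : (1 : ℝ) ≤ 2 ^ (3 * n) := one_le_pow₀ one_le_two
  refine (tvDist_le_of_le_smul _ _ (M := 1 + (2 ^ (3 * n) - 1) * (2 * Δ)) ?_ ?_).trans ?_
  · nlinarith
  · intro A hA
    have h2 := map_cayley_smul_apply_le hH hh hHh hpos hA
    have h3 := ENNReal.toReal_mono (by finiteness) h2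
    rw [ENNReal.toReal_mul, ENNReal.toReal_pow, ENNReal.toReal_ofReal (by positivity)] at h3
    exact h3.trans (mul_le_mul_of_nonneg_right (distortion_pow_le hΔ hθ n) measureReal_nonneg)
  · rw [pow_succ]
    nlinarith
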